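/- Let $X$ be a complex Hilbert space, let $A$ be a bounded linear operator on $X$, and write $R(\lambda,A)=(\lambda-A)^{-1}$. Assume that $A^n x\to 0$ as $n\to\infty$ for every $x\in X$, and that the spectrum of $A$ meets the unit circle exactly in the points $e^{i\varphi_1},\dots,e^{i\varphi_N}$, where the $\varphi_k$ are real and $d_A=\min_{k\ne l}|\varphi_k-\varphi_l|>0$. Assume that there are constants $\alpha\ge 1$, $M_A\ge 1$ and $0<\varepsilon_A\le\min\{\pi/8,d_A/3\}$ (only $0<\varepsilon_A\le\pi/8$ if $N\le 1$) such that $$\sup_{0<|\varphi-\varphi_k|\le\varepsilon_A}|\varphi-\varphi_k|^\alpha\,\|R(e^{i\varphi},A)\|\le M_A\qquad\text{for all }k,$$ and $\|R(e^{i\varphi},A)\|\le M_A$ whenever the distance modulo $2\pi$ from $\varphi$ to $\varphi_k$ is greater than $\varepsilon_A$ for every $k$. Put $\Lambda_k=1-e^{-i\varphi_k}A$, $r_A=|1-e^{i\varepsilon_A}|$ and $$\Omega_k=\{\lambda\in\mathbb C:\ |\lambda|\ge 1,\ 0<|\lambda-e^{i\varphi_k}|\le r_A\}.$$ Let $\Lambda_k^\alpha$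 be the fractional power of the bounded sectorial operator $\Lambda_k$: for $\alpha=n+s$ with an integer $n\geq 1$ and $0\le s<1$, it is $\Lambda_k^n$ if $s=0$, and $$\Lambda_k^\alpha=\Lambda_k^n\,\frac{\sin \pi s}{\pi}\int_0^\infty t^{s-1}(t+\Lambda_k)^{-1}\Lambda_k\,dt\qquad\text{if }0<s<1 .$$ Then these powers are well defined (for $0<s<1$, $t+\Lambda_k$ is boundedly invertible for every $t>0$ and the integral converges absolutely in operator norm), each $\Omega_k$ is contained in the resolvent set of $A$, and there is a constant $M_1\ge 1$ such that $$\sup_{\lambda\in\Omega_k}\|R(\lambda,A)\Lambda_k^\alpha\|\le M_1\qquad\text{for all }k=1,\dots,N.$$ -/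

import Mathlib

open Filter Topology MeasureTheory

noncomputable section

/-- The discrete semigroup `(A ^ n)` is strongly stable: every orbit tends to zero in norm. -/
def StronglyStable {X : Type*} [NormedAddCommGroup X] [NormedSpace ℂ X]
    (A : X →L[ℂ] X) : Prop :=
  ∀ x : X, Tendsto (fun n : ℕ => (A ^ n) x) atTop (𝓝 0)

/-- The integrand `t ^ (s - 1) (t + S)⁻¹ S` of the Balakrishnan formula for `S ^ s`, `0 < s < 1`.
(`Ring.inverse` is the inverse of an invertible operator.) -/
def balakrishnanIntegrand {X : Type*} [NormedAddCommGroup X] [NormedSpace ℂ X]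
    (S : X →L[ℂ] X) (s t : ℝ) : X →L[ℂ] X :=
  ((t ^ (s - 1) : ℝ) : ℂ) • (Ring.inverse ((t : ℂ) • (1 : X →L[ℂ] X) + S) * S)

/-- The formula defining `S ^ a`, `a ≥ 0`, makes sense: if `a` is not an integer, then every
`t + S` with `t > 0` is boundedly invertible, and the Balakrishnan integral for the fractional
part of `a` converges absolutely in operator norm. This is so for every bounded sectorial `S`. -/
def HasFracPow {X : Type*} [NormedAddCommGroup X] [NormedSpace ℂ X]
    (S : X →L[ℂ] X) (a : ℝ) : Prop :=
  Int.fract a ≠ 0 →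
    (∀ t : ℝ, 0 < t → IsUnit ((t : ℂ) • (1 : X →L[ℂ] X) + S)) ∧
      IntegrableOn (balakrishnanIntegrand S (Int.fract a)) (Set.Ioi 0)

/-- The fractional power `S ^ a`, `a ≥ 0`, of a bounded sectorial operator `S`, after Balakrishnan:
with `a = n + s`, `n = ⌊a⌋` and `0 ≤ s < 1`, it is `S ^ n` if `s = 0`, and otherwise
`S ^ n * ((sin (π s) / π) ∫₀^∞ t ^ (s - 1) (t + S)⁻¹ S dt)`. -/
def fracPow {X : Type*} [NormedAddCommGroup X] [NormedSpace ℂ X]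
    (S : X →L[ℂ] X) (a : ℝ) : X →L[ℂ] X :=
  open scoped Classical in
  if Int.fract a = 0 then S ^ ⌊a⌋₊
  else S ^ ⌊a⌋₊ *
    (((Real.sin (Real.pi * Int.fract a) / Real.pi : ℝ) : ℂ) •
      ∫ t in Set.Ioi (0 : ℝ), balakrishnanIntegrand S (Int.fract a) t)

/-- The point `e ^ (i θ)` of the unit circle. -/
def circlePoint (θ : ℝ) : ℂ := Complex.exp (Complex.I * (θ : ℂ))

/-- The operator `Λ = 1 - e ^ (-i θ) A`. -/
def lambdaOp {X : Type*} [NormedAddCommGroup X] [NormedSpace ℂ X]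
    (A : X →L[ℂ] X) (θ : ℝ) : X →L[ℂ] X :=
  1 - circlePoint (-θ) • A

/-- The region `{z : |z| ≥ 1, 0 < |z - e ^ (i θ)| ≤ r}` with `r = |1 - e ^ (i ε)|`. -/
def regionOmega (ε θ : ℝ) : Set ℂ :=
  {z : ℂ | 1 ≤ ‖z‖ ∧ 0 < ‖z - circlePoint θ‖ ∧ ‖z - circlePoint θ‖ ≤ ‖1 - circlePoint ε‖}

/-- Standing assumption on `A`, with exponent `α ≥ 1`, angles `φ k`, and constants `M ≥ 1`, `ε > 0`.
The angles are real representatives. The bound near `e ^ (i φ k)` is required for real `ψ` on both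
sides of `φ k`; in the bound away from these points the distance of angles is taken modulo `2 π`. -/
structure StandingAssumption {X : Type*} [NormedAddCommGroup X] [InnerProductSpace ℂ X]
    (A : X →L[ℂ] X) {N : ℕ} (φ : Fin N → ℝ) (α M ε : ℝ) : Prop where
  one_le_alpha : 1 ≤ α
  stable : StronglyStable A
  spectrum_inter : spectrum ℂ A ∩ Metric.sphere (0 : ℂ) 1 = Set.range fun k => circlePoint (φ k)
  one_le_const : 1 ≤ M
  eps_pos : 0 < ε
  eps_le : ε ≤ Real.pi / 8
  eps_le_gap : ∀ k l : Fin N, k ≠ l → ε ≤ |φ k - φ l| / 3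
  near : ∀ k : Fin N, ∀ ψ : ℝ, 0 < |ψ - φ k| → |ψ - φ k| ≤ ε →
    |ψ - φ k| ^ α * ‖resolvent A (circlePoint ψ)‖ ≤ M
  away : ∀ ψ : ℝ, (∀ k : Fin N, ∀ m : ℤ, ε < |ψ - φ k + 2 * Real.pi * m|) →
    ‖resolvent A (circlePoint ψ)‖ ≤ M

end

section Balakrishnan

variable {X : Type*} [NormedAddCommGroup X] [NormedSpace ℂ X]

theorem Ring.inverse_mul_eq_one_sub_smul {S : X →L[ℂ] X} {c : ℂ}
    (h : IsUnit (c • (1 : X →L[ℂ] X) + S)) :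
    Ring.inverse (c • (1 : X →L[ℂ] X) + S) * S
      = 1 - c • Ring.inverse (c • (1 : X →L[ℂ] X) + S) := by
  have := Ring.inverse_mul_cancel _ h
  rw [mul_add, mul_smul_comm, mul_one] at this
  rw [eq_sub_iff_add_eq, add_comm, this]

theorem Ring.inverse_mul_comm_of_smul_one_add {S : X →L[ℂ] X} {c : ℂ}
    (h : IsUnit (c • (1 : X →L[ℂ] X) + S)) :
    Ring.inverse (c • (1 : X →L[ℂ] X) + S) * S = S * Ring.inverse (c • (1 : X →L[ℂ] X) + S) := by
  rw [Ring.inverse_mul_eq_one_sub_smul h]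
  have := Ring.mul_inverse_cancel _ h
  rw [add_mul, smul_mul_assoc, one_mul] at this
  rw [sub_eq_iff_eq_add', this]

/-- If `‖(t + S)⁻¹‖ ≤ K / t`, then the Balakrishnan integrand multiplied from the left by `Q`
decays like `t ^ (s - 1)` near `0` and like `t ^ (s - 2)` near infinity. -/
theorem norm_mul_balakrishnanIntegrand_le {S : X →L[ℂ] X} {K s t : ℝ} (ht : 0 < t)
    (hu : IsUnit ((t : ℂ) • (1 : X →L[ℂ] X) + S))
    (hK : ‖Ring.inverse ((t : ℂ) • (1 : X →L[ℂ] X) + S)‖ ≤ K / t) (Q : X →L[ℂ] X) :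
    ‖Q * balakrishnanIntegrand S s t‖ ≤ ‖Q‖ * (1 + K) * t ^ (s - 1) ∧
    ‖Q * balakrishnanIntegrand S s t‖ ≤ ‖Q * S‖ * K * t ^ (s - 2) := by
  have hpos : 0 < t ^ (s - 1) := Real.rpow_pos_of_pos ht _
  have hn : ‖Q * balakrishnanIntegrand S s t‖ = t ^ (s - 1) *
      ‖Q * (Ring.inverse ((t : ℂ) • (1 : X →L[ℂ] X) + S) * S)‖ := by
    rw [balakrishnanIntegrand, mul_smul_comm, norm_smul, Complex.norm_real, Real.norm_eq_abs,
      abs_of_pos hpos]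
  constructor
  · rw [hn, mul_comm]
    gcongr
    refine (norm_mul_le _ _).trans ?_
    gcongr
    rw [Ring.inverse_mul_eq_one_sub_smul hu]
    refine (norm_sub_le _ _).trans ?_
    gcongr
    · exact ContinuousLinearMap.norm_id_le
    · rw [norm_smul, Complex.norm_real, Real.norm_eq_abs, abs_of_pos ht]
      calc t * _ ≤ t * (K / t) := by gcongr
        _ = K := by field_simp
  · rw [hn, Ring.inverse_mul_comm_of_smul_one_add hu, ← mul_assoc]
    have e : t ^ (s - 2) = t ^ (s - 1) / t := by
      rw [← Real.rpow_sub_one ht.ne']; ring_nf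
    calc t ^ (s - 1) * ‖Q * S * Ring.inverse ((t : ℂ) • (1 : X →L[ℂ] X) + S)‖
        ≤ t ^ (s - 1) * (‖Q * S‖ * (K / t)) := by
          gcongr
          refine (norm_mul_le _ _).trans ?_
          gcongr
      _ = ‖Q * S‖ * K * t ^ (s - 2) := by rw [e]; ring

theorem continuousOn_balakrishnanIntegrand [CompleteSpace X] {S : X →L[ℂ] X} (s : ℝ)
    (hu : ∀ t : ℝ, 0 < t → IsUnit ((t : ℂ) • (1 : X →L[ℂ] X) + S)) :
    ContinuousOn (balakrishnanIntegrand S s) (Set.Ioi 0) := by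
  intro t ht
  have ht : 0 < t := ht
  refine ContinuousAt.continuousWithinAt ?_
  have hp : ContinuousAt (fun t : ℝ => ((t ^ (s - 1) : ℝ) : ℂ)) t :=
    Complex.continuous_ofReal.continuousAt.comp
      (Real.continuousAt_rpow_const t (s - 1) (Or.inl ht.ne'))
  have hl : Continuous fun t : ℝ => (t : ℂ) • (1 : X →L[ℂ] X) + S := by fun_prop
  have hi : ContinuousAt (fun t : ℝ => Ring.inverse ((t : ℂ) • (1 : X →L[ℂ] X) + S)) t :=
    ContinuousAt.comp (f := fun t : ℝ => (t : ℂ) • (1 : X →L[ℂ] X) + S)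
      (NormedRing.inverse_continuousAt (hu t ht).unit) hl.continuousAt
  exact hp.smul (hi.mul_const S)

theorem integrableOn_Ioc_rpow_sub_one {s δ : ℝ} (hs : 0 < s) (hδ : 0 < δ) :
    IntegrableOn (fun t : ℝ => t ^ (s - 1)) (Set.Ioc 0 δ) :=
  (intervalIntegrable_iff_integrableOn_Ioc_of_le hδ.le).1
    (intervalIntegral.intervalIntegrable_rpow' (by linarith))

theorem integrableOn_balakrishnanIntegrand [CompleteSpace X] {S : X →L[ℂ] X} {K s : ℝ}
    (hs : 0 < s) (hs1 : s < 1)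
    (hu : ∀ t : ℝ, 0 < t → IsUnit ((t : ℂ) • (1 : X →L[ℂ] X) + S))
    (hK : ∀ t : ℝ, 0 < t → ‖Ring.inverse ((t : ℂ) • (1 : X →L[ℂ] X) + S)‖ ≤ K / t) :
    IntegrableOn (balakrishnanIntegrand S s) (Set.Ioi 0) := by
  have hc := continuousOn_balakrishnanIntegrand s hu
  rw [← Set.Ioc_union_Ioi_eq_Ioi zero_le_one]
  refine IntegrableOn.union ?_ ?_
  · refine Integrable.mono'
      ((integrableOn_Ioc_rpow_sub_one hs one_pos).const_mul (‖(1 : X →L[ℂ] X)‖ * (1 + K)))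
      ((hc.mono Set.Ioc_subset_Ioi_self).aestronglyMeasurable measurableSet_Ioc)
      ((ae_restrict_mem measurableSet_Ioc).mono fun t ht => ?_)
    simpa using (norm_mul_balakrishnanIntegrand_le (s := s) ht.1 (hu t ht.1) (hK t ht.1) 1).1
  · refine Integrable.mono'
      ((integrableOn_Ioi_rpow_of_lt (a := s - 2) (by linarith) one_pos).const_mul (‖1 * S‖ * K))
      ((hc.mono (Set.Ioi_subset_Ioi zero_le_one)).aestronglyMeasurable measurableSet_Ioi)
      ((ae_restrict_mem measurableSet_Ioi).mono fun t ht => ?_)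
    have ht : 0 < t := one_pos.trans ht
    simpa using (norm_mul_balakrishnanIntegrand_le (s := s) ht (hu t ht) (hK t ht) 1).2

theorem hasFracPow_of_norm_inverse_le [CompleteSpace X] {S : X →L[ℂ] X} {K : ℝ} (a : ℝ)
    (hu : ∀ t : ℝ, 0 < t → IsUnit ((t : ℂ) • (1 : X →L[ℂ] X) + S))
    (hK : ∀ t : ℝ, 0 < t → ‖Ring.inverse ((t : ℂ) • (1 : X →L[ℂ] X) + S)‖ ≤ K / t) :
    HasFracPow S a := fun h =>
  ⟨hu, integrableOn_balakrishnanIntegrand ((Int.fract_nonneg a).lt_of_ne' h)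
    (Int.fract_lt_one a) hu hK⟩

/-- The moment estimate for `Q S ^ s` in terms of `‖Q‖` and `‖Q S‖`. -/
theorem norm_mul_integral_balakrishnanIntegrand_le [CompleteSpace X] {S : X →L[ℂ] X} {K s δ : ℝ}
    (hs : 0 < s) (hs1 : s < 1) (hδ : 0 < δ)
    (hu : ∀ t : ℝ, 0 < t → IsUnit ((t : ℂ) • (1 : X →L[ℂ] X) + S))
    (hK : ∀ t : ℝ, 0 < t → ‖Ring.inverse ((t : ℂ) • (1 : X →L[ℂ] X) + S)‖ ≤ K / t)
    (Q : X →L[ℂ] X) :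
    ‖Q * ∫ t in Set.Ioi (0 : ℝ), balakrishnanIntegrand S s t‖ ≤
      ‖Q‖ * (1 + K) * (δ ^ s / s) + ‖Q * S‖ * K * (δ ^ (s - 1) / (1 - s)) := by
  have hint := integrableOn_balakrishnanIntegrand hs hs1 hu hK
  have hcomm : Q * ∫ t in Set.Ioi (0 : ℝ), balakrishnanIntegrand S s t =
      ∫ t in Set.Ioi (0 : ℝ), Q * balakrishnanIntegrand S s t :=
    ((ContinuousLinearMap.mul ℂ (X →L[ℂ] X) Q).integral_comp_comm hint).symm
  have hintQ : IntegrableOn (fun t => Q * balakrishnanIntegrand S s t) (Set.Ioi 0) :=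
    (ContinuousLinearMap.mul ℂ (X →L[ℂ] X) Q).integrable_comp hint
  rw [hcomm, ← Set.Ioc_union_Ioi_eq_Ioi hδ.le, setIntegral_union Set.Ioc_disjoint_Ioi_same
    measurableSet_Ioi (hintQ.mono_set Set.Ioc_subset_Ioi_self)
    (hintQ.mono_set (Set.Ioi_subset_Ioi hδ.le))]
  refine (norm_add_le _ _).trans (add_le_add ?_ ?_)
  · have e : ∫ t in Set.Ioc 0 δ, t ^ (s - 1) = δ ^ s / s := by
      rw [← intervalIntegral.integral_of_le hδ.le, integral_rpow (Or.inl (by linarith)),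
        sub_add_cancel, Real.zero_rpow hs.ne', sub_zero]
    rw [← e, ← integral_const_mul]
    refine norm_integral_le_of_norm_le ((integrableOn_Ioc_rpow_sub_one hs hδ).const_mul _)
      ((ae_restrict_mem measurableSet_Ioc).mono fun t ht => ?_)
    exact (norm_mul_balakrishnanIntegrand_le ht.1 (hu t ht.1) (hK t ht.1) Q).1
  · have e : ∫ t in Set.Ioi δ, t ^ (s - 2) = δ ^ (s - 1) / (1 - s) := by
      rw [integral_Ioi_rpow_of_lt (by linarith) hδ, show s - 2 + 1 = s - 1 by ring, neg_div,
        ← div_neg, neg_sub]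
    rw [← e, ← integral_const_mul]
    refine norm_integral_le_of_norm_le
      ((integrableOn_Ioi_rpow_of_lt (by linarith) hδ).const_mul _)
      ((ae_restrict_mem measurableSet_Ioi).mono fun t ht => ?_)
    have ht : 0 < t := hδ.trans ht
    exact (norm_mul_balakrishnanIntegrand_le ht (hu t ht) (hK t ht) Q).2

theorem exists_norm_mul_pow_sub_le (S : X →L[ℂ] X) (n : ℕ) :
    ∃ B : ℝ, 0 ≤ B ∧ ∀ (μ : ℂ) (Q : X →L[ℂ] X), ‖μ‖ ≤ 1 → Q * S = 1 - μ • Q →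
      ‖Q * S ^ n - (-μ) ^ n • Q‖ ≤ B := by
  induction n with
  | zero => exact ⟨0, le_rfl, fun μ Q _ _ => by simp⟩
  | succ n ih =>
    obtain ⟨B, hB, h⟩ := ih
    refine ⟨B * ‖S‖ + 1, by positivity, fun μ Q hμ hQ => ?_⟩
    have e : Q * S ^ (n + 1) - (-μ) ^ (n + 1) • Q =
        (Q * S ^ n - (-μ) ^ n • Q) * S + (-μ) ^ n • (1 : X →L[ℂ] X) := by
      rw [sub_mul, smul_mul_assoc, hQ, pow_succ, pow_succ, mul_assoc]
      module
    rw [e]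
    refine (norm_add_le _ _).trans (add_le_add ?_ ?_)
    · refine (norm_mul_le _ _).trans ?_
      gcongr
      exact h μ Q hμ hQ
    · rw [norm_smul, norm_pow, norm_neg]
      exact mul_le_one₀ (pow_le_one₀ (norm_nonneg _) hμ) (norm_nonneg _)
        ContinuousLinearMap.norm_id_le

/-- If `Q = (μ + S)⁻¹` grows at most like `|μ| ^ (-a)`, then `Q S ^ a` is bounded. -/
theorem exists_norm_mul_fracPow_le [CompleteSpace X] {S : X →L[ℂ] X} {K a C : ℝ} (ha : 1 ≤ a)
    (hK0 : 0 ≤ K)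
    (hu : ∀ t : ℝ, 0 < t → IsUnit ((t : ℂ) • (1 : X →L[ℂ] X) + S))
    (hK : ∀ t : ℝ, 0 < t → ‖Ring.inverse ((t : ℂ) • (1 : X →L[ℂ] X) + S)‖ ≤ K / t) :
    ∃ M : ℝ, ∀ (μ : ℂ) (Q : X →L[ℂ] X), 0 < ‖μ‖ → ‖μ‖ ≤ 1 → Q * S = 1 - μ • Q →
      ‖Q‖ ≤ C * ‖μ‖ ^ (-a) → ‖Q * fracPow S a‖ ≤ M := by
  obtain ⟨B, hB, h⟩ := exists_norm_mul_pow_sub_le S ⌊a⌋₊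
  set n := ⌊a⌋₊ with hn
  have hna : (n : ℝ) + Int.fract a = a := by
    rw [hn, natCast_floor_eq_intCast_floor (by linarith)]
    exact Int.floor_add_fract a
  have hn1 : (1 : ℝ) ≤ n := by
    exact_mod_cast (Nat.one_le_floor_iff a).2 ha
  by_cases hf : Int.fract a = 0
  · refine ⟨B + C, fun μ Q h0 h1 hQ hQC => ?_⟩
    rw [fracPow, if_pos hf, ← sub_add_cancel (Q * S ^ n) ((-μ) ^ n • Q)]
    refine (norm_add_le _ _).trans (add_le_add (h μ Q h1 hQ) ?_)
    rw [norm_smul, norm_pow, norm_neg]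
    calc ‖μ‖ ^ n * ‖Q‖ ≤ ‖μ‖ ^ n * (C * ‖μ‖ ^ (-a)) := by gcongr
      _ = C * ‖μ‖ ^ ((n : ℝ) + -a) := by rw [Real.rpow_add h0, Real.rpow_natCast]; ring
      _ = C := by rw [show (n : ℝ) + -a = 0 by linarith, Real.rpow_zero, mul_one]
  · set s := Int.fract a
    have hs : 0 < s := (Int.fract_nonneg a).lt_of_ne' hf
    have hs1 : s < 1 := Int.fract_lt_one a
    set J := ∫ t in Set.Ioi (0 : ℝ), balakrishnanIntegrand S s t
    set c : ℂ := ((Real.sin (Real.pi * s) / Real.pi : ℝ) : ℂ)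
    refine ⟨‖c‖ * (B * ‖J‖ + (C * (1 + K) / s + (1 + C) * K / (1 - s))),
      fun μ Q h0 h1 hQ hQC => ?_⟩
    rw [fracPow, if_neg hf, mul_smul_comm, mul_smul_comm, norm_smul, ← mul_assoc,
      ← sub_add_cancel (Q * S ^ n) ((-μ) ^ n • Q), add_mul]
    gcongr
    refine (norm_add_le _ _).trans (add_le_add ((norm_mul_le _ _).trans ?_) ?_)
    · gcongr
      exact h μ Q h1 hQ
    · rw [smul_mul_assoc, norm_smul, norm_pow, norm_neg]
      have hQS : ‖Q * S‖ ≤ (1 + C) * ‖μ‖ ^ (1 - a) := by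
        rw [hQ]
        refine (norm_sub_le _ _).trans ?_
        have h2 : (1 : ℝ) ≤ ‖μ‖ ^ (1 - a) :=
          Real.one_le_rpow_of_pos_of_le_one_of_nonpos h0 h1 (by linarith)
        have h3 : ‖μ • Q‖ ≤ C * ‖μ‖ ^ (1 - a) := by
          rw [norm_smul, sub_eq_add_neg, Real.rpow_add h0, Real.rpow_one]
          calc ‖μ‖ * ‖Q‖ ≤ ‖μ‖ * (C * ‖μ‖ ^ (-a)) := by gcongr
            _ = _ := by ring
        have h4 : ‖(1 : X →L[ℂ] X)‖ ≤ 1 := ContinuousLinearMap.norm_id_le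
        linarith
      have key := norm_mul_integral_balakrishnanIntegrand_le hs hs1 h0 hu hK Q
      have hs1' : 0 < 1 - s := by linarith
      have p1 : ‖μ‖ ^ n * (‖μ‖ ^ (-a) * ‖μ‖ ^ s) = 1 := by
        rw [← Real.rpow_natCast, ← Real.rpow_add h0, ← Real.rpow_add h0,
          show (n : ℝ) + (-a + s) = 0 by linarith, Real.rpow_zero]
      have p2 : ‖μ‖ ^ n * (‖μ‖ ^ (1 - a) * ‖μ‖ ^ (s - 1)) = 1 := by
        rw [← Real.rpow_natCast, ← Real.rpow_add h0, ← Real.rpow_add h0,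
          show (n : ℝ) + (1 - a + (s - 1)) = 0 by linarith, Real.rpow_zero]
      calc ‖μ‖ ^ n * ‖Q * J‖
          ≤ ‖μ‖ ^ n * (C * ‖μ‖ ^ (-a) * (1 + K) * (‖μ‖ ^ s / s) +
            (1 + C) * ‖μ‖ ^ (1 - a) * K * (‖μ‖ ^ (s - 1) / (1 - s))) := by
            gcongr
            refine key.trans ?_
            gcongr
        _ = C * (1 + K) / s * (‖μ‖ ^ n * (‖μ‖ ^ (-a) * ‖μ‖ ^ s)) +
            (1 + C) * K / (1 - s) * (‖μ‖ ^ n * (‖μ‖ ^ (1 - a) * ‖μ‖ ^ (s - 1))) := by ring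
        _ = _ := by rw [p1, p2, mul_one, mul_one]

end Balakrishnan

section Resolvent

variable {X : Type*} [NormedAddCommGroup X] [NormedSpace ℂ X]

theorem resolvent_mul_sub {A : X →L[ℂ] X} {z : ℂ} (hz : z ∈ resolventSet ℂ A) :
    resolvent A z * (algebraMap ℂ (X →L[ℂ] X) z - A) = 1 :=
  Ring.inverse_mul_cancel _ hz

theorem sub_mul_resolvent {A : X →L[ℂ] X} {z : ℂ} (hz : z ∈ resolventSet ℂ A) :
    (algebraMap ℂ (X →L[ℂ] X) z - A) * resolvent A z = 1 :=
  Ring.mul_inverse_cancel _ hz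

theorem norm_circlePoint (θ : ℝ) : ‖circlePoint θ‖ = 1 := by
  rw [circlePoint, mul_comm]; exact Complex.norm_exp_ofReal_mul_I θ

theorem circlePoint_ne_zero (θ : ℝ) : circlePoint θ ≠ 0 := Complex.exp_ne_zero _

theorem circlePoint_add (θ ψ : ℝ) : circlePoint (θ + ψ) = circlePoint θ * circlePoint ψ := by
  rw [circlePoint, circlePoint, circlePoint, ← Complex.exp_add]; push_cast; ring_nf

theorem circlePoint_neg (θ : ℝ) : circlePoint (-θ) = (circlePoint θ)⁻¹ := by
  rw [circlePoint, circlePoint, ← Complex.exp_neg]; push_cast; ring_nf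

theorem hasDerivAt_circlePoint (θ : ℝ) :
    HasDerivAt circlePoint (circlePoint θ * Complex.I) θ := by
  have h : HasDerivAt (fun t : ℝ => Complex.I * (t : ℂ)) Complex.I θ := by
    simpa using (Complex.ofRealCLM.hasDerivAt (x := θ)).const_mul Complex.I
  exact h.cexp

theorem continuous_circlePoint : Continuous circlePoint := by
  unfold circlePoint; fun_prop

theorem algebraMap_sub_eq_circlePoint_smul (A : X →L[ℂ] X) (θ : ℝ) (z : ℂ) :
    algebraMap ℂ (X →L[ℂ] X) z - A =
      circlePoint θ • ((z * circlePoint (-θ) - 1) • (1 : X →L[ℂ] X) + lambdaOp A θ) := by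
  have h := mul_inv_cancel₀ (circlePoint_ne_zero θ)
  rw [lambdaOp, Algebra.algebraMap_eq_smul_one, smul_add, smul_sub, smul_smul, smul_smul, mul_sub,
    circlePoint_neg, h, mul_left_comm, h]
  module

/-- The first resolvent identity. -/
theorem resolvent_sub_resolvent {A : X →L[ℂ] X} {z w : ℂ} (hz : z ∈ resolventSet ℂ A)
    (hw : w ∈ resolventSet ℂ A) :
    resolvent A z - resolvent A w = (w - z) • (resolvent A w * resolvent A z) := by
  have h : (algebraMap ℂ (X →L[ℂ] X) w - A) - (algebraMap ℂ (X →L[ℂ] X) z - A)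
      = (w - z) • (1 : X →L[ℂ] X) := by
    rw [sub_sub_sub_cancel_right, ← map_sub, Algebra.algebraMap_eq_smul_one]
  calc resolvent A z - resolvent A w
      = resolvent A w * ((algebraMap ℂ (X →L[ℂ] X) w - A) - (algebraMap ℂ (X →L[ℂ] X) z - A))
        * resolvent A z := by
        rw [mul_sub, sub_mul, mul_assoc _ _ (resolvent A z), mul_assoc _ _ (resolvent A z),
          sub_mul_resolvent hz, ← mul_assoc, resolvent_mul_sub hw, one_mul, mul_one]
    _ = _ := by rw [h, mul_smul_comm, mul_one, smul_mul_assoc]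

theorem resolvent_mul_lambdaOp {A : X →L[ℂ] X} (θ : ℝ) {z : ℂ} (hz : z ∈ resolventSet ℂ A) :
    (circlePoint θ • resolvent A z) * lambdaOp A θ =
      1 - (z * circlePoint (-θ) - 1) • (circlePoint θ • resolvent A z) := by
  have h := resolvent_mul_sub hz
  rw [algebraMap_sub_eq_circlePoint_smul A θ, mul_smul_comm, ← smul_mul_assoc, mul_add,
    mul_smul_comm, mul_one] at h
  rw [← h]; abel

end Resolvent

section PowerBounded

variable {X : Type*} [NormedAddCommGroup X] [NormedSpace ℂ X] [CompleteSpace X]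

theorem StronglyStable.exists_norm_pow_le {A : X →L[ℂ] X} (h : StronglyStable A) :
    ∃ K : ℝ, 1 ≤ K ∧ ∀ n : ℕ, ‖A ^ n‖ ≤ K := by
  obtain ⟨C, hC⟩ := banach_steinhaus (g := fun n : ℕ => A ^ n) fun x => by
    obtain ⟨C, hC⟩ := (h x).norm.bddAbove_range
    exact ⟨C, fun n => hC ⟨n, rfl⟩⟩
  exact ⟨max 1 C, le_max_left _ _, fun n => (hC n).trans (le_max_right _ _)⟩

/-- The resolvent of a power bounded operator outside the closed unit disc. -/
theorem mem_resolventSet_and_norm_resolvent_le_of_norm_pow_le {A : X →L[ℂ] X} {K : ℝ}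
    (hK : ∀ n : ℕ, ‖A ^ n‖ ≤ K) {z : ℂ} (hz : 1 < ‖z‖) :
    z ∈ resolventSet ℂ A ∧ ‖resolvent A z‖ ≤ K / (‖z‖ - 1) := by
  have hz0 : z ≠ 0 := norm_pos_iff.1 (one_pos.trans hz)
  have hzi : ‖z‖⁻¹ < 1 := inv_lt_one_of_one_lt₀ hz
  have hb : ∀ n : ℕ, ‖(z⁻¹ • A) ^ n‖ ≤ K * ‖z‖⁻¹ ^ n := fun n => by
    rw [smul_pow, norm_smul, norm_pow, norm_inv, mul_comm]
    gcongr
    exact hK n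
  have hg : HasSum (fun n : ℕ => K * ‖z‖⁻¹ ^ n) (K * (1 - ‖z‖⁻¹)⁻¹) :=
    (hasSum_geometric_of_lt_one (by positivity) hzi).mul_left K
  have hs : Summable fun n : ℕ => (z⁻¹ • A) ^ n := Summable.of_norm_bounded hg.summable hb
  set T := ∑' n : ℕ, (z⁻¹ • A) ^ n with hT
  have e : algebraMap ℂ (X →L[ℂ] X) z - A = z • (1 - z⁻¹ • A) := by
    rw [smul_sub, smul_smul, mul_inv_cancel₀ hz0, one_smul, Algebra.algebraMap_eq_smul_one]
  let u : (X →L[ℂ] X)ˣ :=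
    { val := algebraMap ℂ (X →L[ℂ] X) z - A
      inv := z⁻¹ • T
      val_inv := by
        rw [e, smul_mul_smul_comm, mul_inv_cancel₀ hz0, one_smul, hs.one_sub_mul_tsum_pow]
      inv_val := by
        rw [e, smul_mul_smul_comm, inv_mul_cancel₀ hz0, one_smul, hs.tsum_pow_mul_one_sub] }
  refine ⟨u.isUnit, ?_⟩
  have hr : resolvent A z = z⁻¹ • T := Ring.inverse_unit u
  rw [hr, norm_smul, norm_inv]
  calc ‖z‖⁻¹ * ‖T‖ ≤ ‖z‖⁻¹ * (K * (1 - ‖z‖⁻¹)⁻¹) := by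
        gcongr
        exact tsum_of_norm_bounded hg hb
    _ = K / (‖z‖ - 1) := by
        have : ‖z‖ ≠ 0 := norm_ne_zero_iff.2 hz0
        have h2 : ‖z‖ - 1 ≠ 0 := by linarith
        field_simp

theorem mem_resolventSet_of_norm_sub_mul_lt_one {A : X →L[ℂ] X} {z w : ℂ}
    (hz : z ∈ resolventSet ℂ A) (h : ‖z - w‖ * ‖resolvent A z‖ < 1) : w ∈ resolventSet ℂ A := by
  have e : algebraMap ℂ (X →L[ℂ] X) w - A =
      (algebraMap ℂ (X →L[ℂ] X) z - A) * (1 - (z - w) • resolvent A z) := by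
    rw [mul_sub, mul_smul_comm, sub_mul_resolvent hz, mul_one, sub_smul,
      Algebra.algebraMap_eq_smul_one, Algebra.algebraMap_eq_smul_one]
    abel
  rw [spectrum.mem_resolventSet_iff, e]
  exact hz.mul (isUnit_one_sub_of_norm_lt_one (by rwa [norm_smul]))

/-- `1 - e ^ (-i θ) A` is sectorial if `A` is power bounded. -/
theorem isUnit_and_norm_inverse_smul_one_add_lambdaOp_le {A : X →L[ℂ] X} {K : ℝ}
    (hK : ∀ n : ℕ, ‖A ^ n‖ ≤ K) (θ : ℝ) {t : ℝ} (ht : 0 < t) :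
    IsUnit ((t : ℂ) • (1 : X →L[ℂ] X) + lambdaOp A θ) ∧
      ‖Ring.inverse ((t : ℂ) • (1 : X →L[ℂ] X) + lambdaOp A θ)‖ ≤ K / t := by
  set z : ℂ := ((1 + t : ℝ) : ℂ) * circlePoint θ with hzdef
  have hzn : ‖z‖ = 1 + t := by
    rw [hzdef, norm_mul, norm_circlePoint, Complex.norm_real, mul_one, Real.norm_eq_abs,
      abs_of_pos (by linarith)]
  obtain ⟨hz, hb⟩ := mem_resolventSet_and_norm_resolvent_le_of_norm_pow_le hK
    (z := z) (by rw [hzn]; linarith)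
  have e : algebraMap ℂ (X →L[ℂ] X) z - A =
      circlePoint θ • ((t : ℂ) • (1 : X →L[ℂ] X) + lambdaOp A θ) := by
    rw [algebraMap_sub_eq_circlePoint_smul A θ, hzdef, mul_assoc, circlePoint_neg,
      mul_inv_cancel₀ (circlePoint_ne_zero θ)]
    push_cast
    congr 3; ring
  have h1 := resolvent_mul_sub hz
  have h2 := sub_mul_resolvent hz
  rw [e, mul_smul_comm, ← smul_mul_assoc] at h1
  rw [e, smul_mul_assoc, ← mul_smul_comm] at h2
  let u : (X →L[ℂ] X)ˣ := ⟨_, _, h2, h1⟩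
  refine ⟨u.isUnit, ?_⟩
  have hr : Ring.inverse ((t : ℂ) • (1 : X →L[ℂ] X) + lambdaOp A θ) =
    circlePoint θ • resolvent A z := Ring.inverse_unit u
  rw [hr, norm_smul, norm_circlePoint, one_mul]
  rwa [hzn, add_sub_cancel_left] at hb

end PowerBounded

section Region

theorem norm_circlePoint_sub_one_le (θ : ℝ) : ‖circlePoint θ - 1‖ ≤ |θ| :=
  Real.norm_exp_I_mul_ofReal_sub_one_le

theorem abs_le_of_norm_circlePoint_sub_one_le {θ ε : ℝ} (hθ : |θ| ≤ Real.pi) (hε : 0 ≤ ε)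
    (hε1 : ε ≤ Real.pi) (h : ‖circlePoint θ - 1‖ ≤ ‖circlePoint ε - 1‖) : |θ| ≤ ε := by
  have hpi := Real.pi_pos
  have key : ∀ x : ℝ, |x| ≤ Real.pi → ‖circlePoint x - 1‖ = 2 * Real.sin (|x| / 2) := fun x hx => by
    rw [circlePoint, Complex.norm_exp_I_mul_ofReal_sub_one, norm_mul, Real.norm_eq_abs,
      Real.norm_eq_abs, abs_of_pos (two_pos : (0 : ℝ) < 2),
      Real.abs_sin_eq_sin_abs_of_abs_le_pi (by rw [abs_div, abs_two]; linarith), abs_div, abs_two]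
  rw [key θ hθ, key ε (by rwa [abs_of_nonneg hε]), abs_of_nonneg hε] at h
  by_contra! hlt
  have := Real.sin_lt_sin_of_lt_of_le_pi_div_two (x := ε / 2) (y := |θ| / 2) (by linarith)
    (by linarith) (by linarith)
  linarith

/-- Radial projection to the unit disc does not increase the distance to `1`. -/
theorem norm_sub_one_le_norm_mul_sub_one {u : ℂ} (hu : ‖u‖ = 1) {ρ : ℝ} (hρ : 1 ≤ ρ) :
    ‖u - 1‖ ≤ ‖(ρ : ℂ) * u - 1‖ := by
  have h1 : u.re ≤ 1 := hu ▸ Complex.re_le_norm u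
  have h2 : u.re * u.re + u.im * u.im = 1 := by
    rw [← Complex.normSq_apply, Complex.normSq_eq_norm_sq, hu, one_pow]
  rw [← sq_le_sq₀ (norm_nonneg _) (norm_nonneg _), ← Complex.normSq_eq_norm_sq,
    ← Complex.normSq_eq_norm_sq, Complex.normSq_apply, Complex.normSq_apply]
  simp only [Complex.sub_re, Complex.sub_im, Complex.one_re, Complex.one_im, Complex.re_ofReal_mul,
    Complex.im_ofReal_mul]
  have h3 : ρ ^ 2 * (u.re * u.re + u.im * u.im) = ρ ^ 2 := by rw [h2, mul_one]
  nlinarith [mul_nonneg (sub_nonneg.2 hρ) (sub_nonneg.2 h1), sq_nonneg (ρ - 1)]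

theorem exists_polar_of_mem_regionOmega {ε θ : ℝ} (hε : 0 < ε) (hε1 : ε ≤ Real.pi / 8) {z : ℂ}
    (hz : z ∈ regionOmega ε θ) :
    ∃ ψ : ℝ, |ψ| ≤ ε ∧ z = (‖z‖ : ℂ) * circlePoint (θ + ψ) ∧
      ‖z - circlePoint θ‖ ≤ (‖z‖ - 1) + |ψ| := by
  obtain ⟨h1, -, hr⟩ := hz
  have hpi := Real.pi_pos
  set u : ℂ := z * circlePoint (-θ) with hu
  have hθ : circlePoint (-θ) * circlePoint θ = 1 := by
    rw [circlePoint_neg, inv_mul_cancel₀ (circlePoint_ne_zero θ)]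
  have hzu : z = u * circlePoint θ := by rw [hu, mul_assoc, hθ, mul_one]
  have hun : ‖u‖ = ‖z‖ := by rw [hu, norm_mul, norm_circlePoint, mul_one]
  have hd : ‖z - circlePoint θ‖ = ‖u - 1‖ := by
    conv_lhs => rw [hzu]
    rw [← sub_one_mul, norm_mul, norm_circlePoint, mul_one]
  have hpol : u = (‖z‖ : ℂ) * circlePoint u.arg := by
    rw [← hun, circlePoint, mul_comm Complex.I, Complex.norm_mul_exp_arg_mul_I]
  refine ⟨u.arg, ?_, ?_, ?_⟩
  · refine abs_le_of_norm_circlePoint_sub_one_le (Complex.abs_arg_le_pi u) hε.le (by linarith) ?_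
    refine (norm_sub_one_le_norm_mul_sub_one (norm_circlePoint _) h1).trans ?_
    rw [← hpol, ← hd, norm_sub_rev (circlePoint ε)]
    exact hr
  · rw [circlePoint_add, mul_left_comm, ← hpol, mul_comm, ← hzu]
  · rw [hd]
    have e : u - 1 = ((‖z‖ - 1 : ℝ) : ℂ) * circlePoint u.arg + (circlePoint u.arg - 1) := by
      conv_lhs => rw [hpol]
      push_cast; ring
    rw [e]
    refine (norm_add_le _ _).trans (add_le_add ?_ (norm_circlePoint_sub_one_le _))
    rw [norm_mul, norm_circlePoint, mul_one, Complex.norm_real, Real.norm_eq_abs,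
      abs_of_nonneg (by linarith)]

theorem norm_sub_circlePoint_le_one_of_mem_regionOmega {ε θ : ℝ} (hε : 0 < ε)
    (hε1 : ε ≤ Real.pi / 8) {z : ℂ} (hz : z ∈ regionOmega ε θ) : ‖z - circlePoint θ‖ ≤ 1 := by
  refine hz.2.2.trans ?_
  rw [norm_sub_rev]
  refine (norm_circlePoint_sub_one_le ε).trans ?_
  rw [abs_of_pos hε]
  linarith [Real.pi_le_four]

end Region

namespace StandingAssumption

variable {X : Type*} [NormedAddCommGroup X] [InnerProductSpace ℂ X] [CompleteSpace X]
  {A : X →L[ℂ] X} {N : ℕ} {φ : Fin N → ℝ} {α M ε : ℝ}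

theorem circlePoint_mem_resolventSet (h : StandingAssumption A φ α M ε) {k : Fin N} {ψ : ℝ}
    (h0 : 0 < |ψ - φ k|) (h1 : |ψ - φ k| ≤ ε) : circlePoint ψ ∈ resolventSet ℂ A := by
  have hα : 0 ≤ α := by linarith [h.one_le_alpha]
  have hd : ψ - φ k ≠ 0 := abs_pos.1 h0
  let g : ℝ → ℝ := fun τ => φ k + τ * (ψ - φ k)
  have hg : HasDerivAt g (ψ - φ k) 1 := by
    have h := ((hasDerivAt_id (1 : ℝ)).mul_const (ψ - φ k)).const_add (φ k)
    rw [one_mul] at h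
    exact h
  have hg1 : g 1 = ψ := by simp only [g]; ring
  have hcont : Tendsto (fun τ => circlePoint (g τ)) (𝓝[<] 1) (𝓝 (circlePoint ψ)) := by
    have : ContinuousAt (fun τ => circlePoint (g τ)) 1 :=
      continuous_circlePoint.continuousAt.comp hg.continuousAt
    have h2 := this.tendsto
    rw [hg1] at h2
    exact h2.mono_left nhdsWithin_le_nhds
  have hne : ∀ᶠ τ in 𝓝[<] (1 : ℝ), circlePoint (g τ) ≠ circlePoint ψ := by
    have hder : HasDerivAt (circlePoint ∘ g) ((ψ - φ k) • (circlePoint (g 1) * Complex.I)) 1 :=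
      (hasDerivAt_circlePoint (g 1)).scomp 1 hg
    have := hder.eventually_ne (c := circlePoint ψ)
      (smul_ne_zero hd (mul_ne_zero (circlePoint_ne_zero _) Complex.I_ne_zero))
    exact this.filter_mono (nhdsWithin_mono _ fun x hx => ne_of_lt hx)
  set F : Set ℂ := Set.range (fun k => circlePoint (φ k)) \ {circlePoint ψ} with hF
  have hFc : IsClosed F := ((Set.finite_range _).subset Set.sdiff_subset).isClosed
  have hres : ∀ᶠ τ in 𝓝[<] (1 : ℝ), circlePoint (g τ) ∈ resolventSet ℂ A := by
    have hev := hcont.eventually (hFc.isOpen_compl.mem_nhds (x := circlePoint ψ) (by simp [hF]))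
    filter_upwards [hev, hne] with τ h3 h4
    by_contra h5
    have h6 : circlePoint (g τ) ∈ spectrum ℂ A ∩ Metric.sphere (0 : ℂ) 1 :=
      ⟨h5, by simp [norm_circlePoint]⟩
    rw [h.spectrum_inter] at h6
    exact h3 ⟨h6, h4⟩
  have hbound : ∀ᶠ τ in 𝓝[<] (1 : ℝ),
      ‖resolvent A (circlePoint (g τ))‖ ≤ M / (|ψ - φ k| / 2) ^ α := by
    have hIoo : ∀ᶠ τ in 𝓝[<] (1 : ℝ), τ ∈ Set.Ioo (1 / 2 : ℝ) 1 :=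
      Ioo_mem_nhdsLT (by norm_num)
    filter_upwards [hIoo] with τ hτ
    have e : |g τ - φ k| = τ * |ψ - φ k| := by
      simp only [g]
      rw [add_sub_cancel_left, abs_mul, abs_of_pos (by linarith [hτ.1])]
    have h3 := h.near k (g τ) (by rw [e]; nlinarith [hτ.1]) (by rw [e]; nlinarith [hτ.2])
    rw [le_div_iff₀ (by positivity), mul_comm]
    refine le_trans ?_ h3
    gcongr
    rw [e]; nlinarith [hτ.1]
  have hlim : Tendsto (fun τ => ‖circlePoint (g τ) - circlePoint ψ‖ *
      (M / (|ψ - φ k| / 2) ^ α)) (𝓝[<] 1) (𝓝 0) := by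
    have := ((hcont.sub_const (circlePoint ψ)).norm).mul_const (M / (|ψ - φ k| / 2) ^ α)
    simpa using this
  obtain ⟨τ, h3, h4, h5⟩ :=
    (hres.and (hbound.and (hlim.eventually (gt_mem_nhds one_pos)))).exists
  refine mem_resolventSet_of_norm_sub_mul_lt_one h3 (lt_of_le_of_lt ?_ h5)
  gcongr

/-- On the region outside the unit disc near `e ^ (i φ_k)` the resolvent grows at most like
`|z - e ^ (i φ_k)| ^ (-α)`. -/
theorem exists_norm_resolvent_le (h : StandingAssumption A φ α M ε) {K : ℝ} (hK1 : 1 ≤ K)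
    (hK : ∀ n : ℕ, ‖A ^ n‖ ≤ K) :
    ∃ C : ℝ, ∀ k : Fin N, ∀ z ∈ regionOmega ε (φ k), z ∈ resolventSet ℂ A ∧
      ‖resolvent A z‖ ≤ C * ‖z - circlePoint (φ k)‖ ^ (-α) := by
  have hα := h.one_le_alpha
  have hM := h.one_le_const
  refine ⟨2 * K + (1 + K) * M * 2 ^ α, fun k z hz => ?_⟩
  have hδ1 := norm_sub_circlePoint_le_one_of_mem_regionOmega h.eps_pos h.eps_le hz
  obtain ⟨ψ, hψ, hzψ, hle⟩ := exists_polar_of_mem_regionOmega h.eps_pos h.eps_le hz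
  obtain ⟨hz1, hδ, -⟩ := hz
  set δ := ‖z - circlePoint (φ k)‖ with hδdef
  have hδα : 0 < δ ^ (-α) := Real.rpow_pos_of_pos hδ _
  have out : 1 < ‖z‖ → z ∈ resolventSet ℂ A ∧ ‖resolvent A z‖ ≤ K / (‖z‖ - 1) :=
    fun hlt => mem_resolventSet_and_norm_resolvent_le_of_norm_pow_le hK hlt
  by_cases hcase : δ / 2 ≤ ‖z‖ - 1
  · obtain ⟨hr, hb⟩ := out (by linarith)
    refine ⟨hr, hb.trans ?_⟩
    calc K / (‖z‖ - 1) ≤ K / (δ / 2) := by gcongr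
      _ = 2 * K * δ ^ (-1 : ℝ) := by rw [Real.rpow_neg_one]; field_simp
      _ ≤ 2 * K * δ ^ (-α) := by
        gcongr 2 * K * ?_
        exact Real.rpow_le_rpow_of_exponent_ge hδ hδ1 (by linarith)
      _ ≤ _ := by
        gcongr
        have : 0 ≤ (1 + K) * M * 2 ^ α := by positivity
        linarith
  · push Not at hcase
    have hψδ : δ / 2 ≤ |ψ| := by linarith
    have e1 : φ k + ψ - φ k = ψ := by ring
    have hψ0 : 0 < |ψ| := by linarith
    have hres := h.circlePoint_mem_resolventSet (k := k) (ψ := φ k + ψ) (by rwa [e1]) (by rwa [e1])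
    have hnear := h.near k (φ k + ψ) (by rwa [e1]) (by rwa [e1])
    rw [e1] at hnear
    set w := circlePoint (φ k + ψ) with hw
    have hRw : ‖resolvent A w‖ ≤ M * 2 ^ α * δ ^ (-α) := by
      have e2 : M * 2 ^ α * δ ^ (-α) = M / (δ / 2) ^ α := by
        rw [Real.div_rpow hδ.le two_pos.le, Real.rpow_neg hδ.le]; field_simp
      rw [e2, le_div_iff₀ (by positivity), mul_comm]
      refine le_trans ?_ hnear
      gcongr
    have hzw : ‖w - z‖ = ‖z‖ - 1 := by
      have e3 : w - z = ((1 - ‖z‖ : ℝ) : ℂ) * w := by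
        conv_lhs => rw [hzψ]
        push_cast; ring
      rw [e3, norm_mul, norm_circlePoint, mul_one, Complex.norm_real, Real.norm_eq_abs, abs_sub_comm,
        abs_of_nonneg (by linarith)]
    have hzK : z ∈ resolventSet ℂ A ∧ (‖z‖ - 1) * ‖resolvent A z‖ ≤ K := by
      rcases hz1.eq_or_lt with heq | hlt
      · have : z = w := by rw [hzψ, ← heq, Complex.ofReal_one, one_mul]
        refine ⟨this ▸ hres, ?_⟩
        rw [← heq, sub_self, zero_mul]
        linarith
      · obtain ⟨hr, hb⟩ := out hlt
        refine ⟨hr, ?_⟩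
        rwa [le_div_iff₀ (by linarith), mul_comm] at hb
    refine ⟨hzK.1, ?_⟩
    have hid := resolvent_sub_resolvent hzK.1 hres
    calc ‖resolvent A z‖
        = ‖resolvent A w + (w - z) • (resolvent A w * resolvent A z)‖ := by
          rw [← hid, add_sub_cancel]
      _ ≤ ‖resolvent A w‖ + ‖w - z‖ * (‖resolvent A w‖ * ‖resolvent A z‖) := by
          refine (norm_add_le _ _).trans ?_
          rw [norm_smul]
          gcongr
          exact norm_mul_le _ _
      _ = ‖resolvent A w‖ * (1 + (‖z‖ - 1) * ‖resolvent A z‖) := by rw [hzw]; ring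
      _ ≤ M * 2 ^ α * δ ^ (-α) * (1 + K) := by
          gcongr
          exact hzK.2
      _ = (1 + K) * M * 2 ^ α * δ ^ (-α) := by ring
      _ ≤ _ := by
          gcongr
          linarith

end StandingAssumption

theorem theorem2 {X : Type*} [NormedAddCommGroup X] [InnerProductSpace ℂ X] [CompleteSpace X]
    (A : X →L[ℂ] X) {N : ℕ} (φ : Fin N → ℝ) (α M_A ε_A : ℝ)
    (hA : StandingAssumption A φ α M_A ε_A) :
    ∃ M₁ : ℝ, 1 ≤ M₁ ∧ ∀ k : Fin N,
      HasFracPow (lambdaOp A (φ k)) α ∧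
      ∀ z ∈ regionOmega ε_A (φ k),
        z ∈ resolventSet ℂ A ∧
        ‖resolvent A z * fracPow (lambdaOp A (φ k)) α‖ ≤ M₁ := by
  obtain ⟨K, hK1, hK⟩ := hA.stable.exists_norm_pow_le
  obtain ⟨C, hC⟩ := hA.exists_norm_resolvent_le hK1 hK
  have hS := fun k t (ht : 0 < t) =>
    isUnit_and_norm_inverse_smul_one_add_lambdaOp_le hK (φ k) (t := t) ht
  choose M hM using fun k => exists_norm_mul_fracPow_le (C := C) hA.one_le_alpha
    (zero_le_one.trans hK1) (fun t ht => (hS k t ht).1) (fun t ht => (hS k t ht).2)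
  obtain ⟨B, hB⟩ := (Set.finite_range M).bddAbove
  refine ⟨max 1 B, le_max_left _ _, fun k => ⟨hasFracPow_of_norm_inverse_le α
    (fun t ht => (hS k t ht).1) (fun t ht => (hS k t ht).2), fun z hz => ?_⟩⟩
  obtain ⟨hr, hb⟩ := hC k z hz
  refine ⟨hr, le_trans ?_ ((hB ⟨k, rfl⟩).trans (le_max_right _ _))⟩
  have hμ : ‖z * circlePoint (-φ k) - 1‖ = ‖z - circlePoint (φ k)‖ := by
    have e : z - circlePoint (φ k) = (z * circlePoint (-φ k) - 1) * circlePoint (φ k) := by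
      rw [sub_mul, mul_assoc, circlePoint_neg, inv_mul_cancel₀ (circlePoint_ne_zero _), mul_one,
        one_mul]
    rw [e, norm_mul, norm_circlePoint, mul_one]
  have key := hM k (z * circlePoint (-φ k) - 1) (circlePoint (φ k) • resolvent A z)
    (by rw [hμ]; exact hz.2.1)
    (by rw [hμ]; exact norm_sub_circlePoint_le_one_of_mem_regionOmega hA.eps_pos hA.eps_le hz)
    (resolvent_mul_lambdaOp (φ k) hr)
    (by rwa [hμ, norm_smul, norm_circlePoint, one_mul])
  rwa [smul_mul_assoc, norm_smul, norm_circlePoint, one_mul] at key
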